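/- Let $p$ be an odd prime. For a finite group $G$ and an element $F=\sum_{g\in G}a_g\,g$ of the group ring $\mathbb Z[G]$, let $$M_G(F)=\det\left(a_{gh^{-1}}\right)_{g,h\in G}$$ be its integer group determinant. Let $H_p$ be the Heisenberg group of order $p^3$, that is, the group under multiplication of the matrices $\begin{pmatrix}1&a&c\\0&1&b\\0&0&1\end{pmatrix}$ with $a,b,c\in\mathbb Z_p=\mathbb Z/p\mathbb Z$. Let $x,y,z\in H_p$ be the matrices with $(a,b,c)=(0,1,0)$, $(1,0,0)$, $(0,0,1)$ respectively. Every $F\in\mathbb Z[H_p]$ can be written in exactly one way as $$F(x,y,z)=\sum_{0\le i,j,k<p}a_{ijk}\,x^iy^jz^k,\qquad a_{ijk}\in\mathbb Z;$$ put $F(1,1,1)=\sum_{0\le i,j,k<p}a_{ijk}$. Then $$M_{H_p}(F)\equiv F(1,1,1)^{p^3}\pmod{p^3}.$$ The same congruence holds for $\mathbb Z_p^3$: if $x,y,z$ are the three standard generators of $\mathbb Z_p^3$ (written multiplicatively), then every $F\in\mathbb Z[\mathbb Z_p^3]$ can be written in exactly one way as $F=\sum_{0\le i,j,k<p}a_{ijk}\,x^iy^jz^k$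 with $a_{ijk}\in\mathbb Z$, and, with $F(1,1,1)=\sum_{0\le i,j,k<p}a_{ijk}$, $$M_{\mathbb Z_p^3}(F)\equiv F(1,1,1)^{p^3}\pmod{p^3}.$$ -/

import Mathlib

/-- The Heisenberg group `H(R)` over a commutative ring `R`: the group, under matrix
multiplication, of the upper unitriangular `3 × 3` matrices with entries in `R`. -/
def heisenberg (R : Type*) [CommRing R] : Subgroup (Matrix.SpecialLinearGroup (Fin 3) R) where
  carrier := {A | ∃ a b c : R, (A : Matrix (Fin 3) (Fin 3) R) = !![1, a, c; 0, 1, b; 0, 0, 1]}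
  one_mem' := ⟨0, 0, 0, by
    ext i j; fin_cases i <;> fin_cases j <;> simp⟩
  mul_mem' := by
    rintro A B ⟨a, b, c, hA⟩ ⟨a', b', c', hB⟩
    refine ⟨a + a', b + b', c + a * b' + c', ?_⟩
    rw [Matrix.SpecialLinearGroup.coe_mul, hA, hB]
    ext i j
    fin_cases i <;> fin_cases j <;> simp [Matrix.mul_apply, Fin.sum_univ_three] <;> ring
  inv_mem' := by
    rintro A ⟨a, b, c, hA⟩
    refine ⟨-a, -b, a * b - c, ?_⟩
    rw [Matrix.SpecialLinearGroup.coe_inv, hA]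
    ext i j
    fin_cases i <;> fin_cases j <;> simp [Matrix.adjugate_fin_three]

/-- The element of `H(R)` with entries `a` (position `(1,2)`), `b` (position `(2,3)`) and `c`
(position `(1,3)`) above the diagonal. -/
def heisenbergMk {R : Type*} [CommRing R] (a b c : R) : heisenberg R :=
  ⟨⟨!![1, a, c; 0, 1, b; 0, 0, 1], by simp [Matrix.det_fin_three]⟩, ⟨a, b, c, rfl⟩⟩

/-- The generator `x` of the Heisenberg group. -/
def heisenbergX (R : Type*) [CommRing R] : heisenberg R := heisenbergMk 0 1 0

/-- The generator `y` of the Heisenberg group. -/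
def heisenbergY (R : Type*) [CommRing R] : heisenberg R := heisenbergMk 1 0 0

/-- The central generator `z` of the Heisenberg group. -/
def heisenbergZ (R : Type*) [CommRing R] : heisenberg R := heisenbergMk 0 0 1

instance heisenberg_finite (R : Type*) [CommRing R] [Finite R] : Finite (heisenberg R) :=
  Finite.of_surjective (fun t : R × R × R => heisenbergMk t.1 t.2.1 t.2.2) (by
    rintro ⟨A, a, b, c, hA⟩
    exact ⟨(a, b, c), Subtype.ext (Subtype.ext hA.symm)⟩)

open Classical in
/-- The integer group determinant `M_G(F) = det (a_{g h⁻¹})_{g, h ∈ G}` of an element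
`F = ∑ a_g g` of the group ring `ℤ[G]` of a finite group `G`. -/
noncomputable def groupDet {G : Type*} [Group G] [Finite G] (F : MonoidAlgebra ℤ G) : ℤ :=
  letI : Fintype G := Fintype.ofFinite G
  Matrix.det (Matrix.of fun g h : G => F.coeff (g * h⁻¹))

/-- The element `∑_{0 ≤ i, j, k < p} a_{ijk} x^i y^j z^k` of the group ring `ℤ[G]`, for group
elements `x, y, z`. -/
noncomputable def groupRingPoly {G : Type*} [Group G] {p : ℕ} (x y z : G)
    (a : Fin p → Fin p → Fin p → ℤ) : MonoidAlgebra ℤ G :=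
  ∑ i : Fin p, ∑ j : Fin p, ∑ k : Fin p,
    MonoidAlgebra.single (x ^ (i : ℕ) * y ^ (j : ℕ) * z ^ (k : ℕ)) (a i j k)

/-- The group `ℤ_p³`, written multiplicatively. -/
abbrev ZModCube (p : ℕ) : Type := Multiplicative (Fin 3 → ZMod p)

/-- The three standard generators of `ℤ_p³`. -/
def zmodCubeGen (p : ℕ) (i : Fin 3) : ZModCube p := Multiplicative.ofAdd (Pi.single i 1)

/-! Both congruences are instances of one about any group `G` of order `p ^ n` and exponent `p`
(`groupDet_modEq_of_exponent`), proved by induction on `n`. Take a central subgroup `C` of order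
`p`, with quotient `Q`. Over the commutative ring `ℤ[C]`, `F` becomes a `Q × Q` matrix with
determinant `Δ`. The group determinant of `Δ` is that of `F`, and the augmentation of `Δ` is the
group determinant of the image of `F` in `ℤ[Q]`, which the induction controls.

The crux is that `|Q|` divides every coefficient of `Δ` away from `1` (`dvd_coeff_det_blockMatrix`).
The terms of the Leibniz expansion are `C`-equivariant permutations of `G`, and `G` conjugates them,
preserving weight and degree. A term fixed by some `h ∉ C` has degree `1`, by a transfer argument;
every other orbit has size divisible by `|Q|`.

So the group matrix of `Δ` is diagonal modulo `|Q|`. Its determinant is the `p`-th power of the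
coefficient at `1` modulo `|Q| ^ 2`, and taking `p`-th powers gains the missing factor `p`. -/

/-! ### Determinants, orbit sums and invariant products -/

/-- The determinant of an integer matrix whose off-diagonal entries are divisible by `m` is, modulo
`m ^ 2`, the product of the diagonal entries. -/
theorem Matrix.det_modEq_prod_diag {n : Type*} [Fintype n] [DecidableEq n] (A : Matrix n n ℤ)
    (m : ℤ) (h : ∀ i j, i ≠ j → m ∣ A i j) : A.det ≡ ∏ i, A i i [ZMOD m ^ 2] := by
  rw [Matrix.det_apply, ← Finset.add_sum_erase _ _ (Finset.mem_univ (1 : Equiv.Perm n))]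
  simp only [Equiv.Perm.sign_one, one_smul, Equiv.Perm.one_apply]
  refine (Int.modEq_iff_dvd.2 ?_).symm
  rw [add_sub_cancel_left]
  refine Finset.dvd_sum fun σ hσ => ?_
  obtain ⟨i, hi⟩ : ∃ i, σ i ≠ i := by
    by_contra! hc
    exact (Finset.mem_erase.1 hσ).1 (Equiv.ext hc)
  -- A nontrivial permutation moves at least two points, here `i` and `σ i`, so two off-diagonal
  -- factors occur.
  have hi' : σ (σ i) ≠ σ i := fun hc => hi (σ.injective hc)
  rw [← Finset.mul_prod_erase _ _ (Finset.mem_univ i), ← Finset.mul_prod_erase _ _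
    (Finset.mem_erase.2 ⟨hi, Finset.mem_univ (σ i)⟩), ← mul_assoc, Units.smul_def, smul_eq_mul, sq]
  exact Dvd.dvd.mul_left (Dvd.dvd.mul_right (mul_dvd_mul (h _ _ hi) (h _ _ hi')) _) _

/-- If every orbit on which an invariant function does not vanish has cardinality divisible by
`N`, then so is the sum of the function. -/
theorem MulAction.dvd_sum_of_dvd_card_orbit {G X : Type*} [Group G] [MulAction G X] [Fintype X]
    (u : X → ℤ) (hu : ∀ (g : G) x, u (g • x) = u x) (N : ℕ)
    (h : ∀ x, u x ≠ 0 → N ∣ Nat.card (MulAction.orbit G x)) : (N : ℤ) ∣ ∑ x, u x := by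
  classical
  rw [← Equiv.sum_comp (MulAction.selfEquivSigmaOrbits G X).symm, Fintype.sum_sigma]
  refine Finset.dvd_sum fun ω _ => ?_
  have key : ∀ y : MulAction.orbit G ω.out,
      u ((MulAction.selfEquivSigmaOrbits G X).symm ⟨ω, y⟩) = u ω.out := by
    rintro ⟨_, g, rfl⟩
    exact hu g _
  rw [Finset.sum_congr rfl fun y _ => key y, Finset.sum_const, Finset.card_univ, nsmul_eq_mul]
  by_cases h0 : u ω.out = 0
  · simp [h0]
  · rw [← Nat.card_eq_fintype_card]
    exact Dvd.dvd.mul_right (Int.natCast_dvd_natCast.2 (h _ h0)) _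

/-- A function on a finite group that is invariant under right multiplication by `t` and takes
values in a group of exponent dividing the order of `t` has product `1`. -/
theorem prod_eq_one_of_mul_right_invariant {Q C : Type*} [Group Q] [Fintype Q] [CommGroup C]
    (k : Q → C) (t : Q) (hk : ∀ q, k (q * t) = k q) (hC : ∀ c : C, c ^ orderOf t = 1) :
    ∏ q, k q = 1 := by
  classical
  have hz : ∀ x ∈ Subgroup.zpowers t, ∀ q, k (q * x) = k q := by
    intro x hx
    obtain ⟨n, rfl⟩ := mem_powers_iff_mem_zpowers.2 hx
    clear hx
    change ∀ q, k (q * t ^ n) = k q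
    induction n with
    | zero => simp
    | succ n ih => intro q; rw [pow_succ, ← mul_assoc, hk, ih]
  let φ : (Q ⧸ Subgroup.zpowers t) × Subgroup.zpowers t → Q := fun x => x.1.out * x.2
  have hφ : Function.Bijective φ := by
    constructor
    · rintro ⟨a, x⟩ ⟨b, y⟩ hab
      have h1 : a = b := by
        have := congrArg (QuotientGroup.mk (s := Subgroup.zpowers t)) hab
        simpa [φ, QuotientGroup.mk_mul_of_mem] using this
      subst h1
      exact Prod.ext rfl (Subtype.ext (mul_left_cancel hab))
    · intro q
      refine ⟨(q, ⟨(q : Q ⧸ Subgroup.zpowers t).out⁻¹ * q, ?_⟩), by simp [φ]⟩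
      exact QuotientGroup.eq.1 (QuotientGroup.out_eq' _)
  rw [← Equiv.prod_comp (Equiv.ofBijective φ hφ), Fintype.prod_prod_type]
  refine Finset.prod_eq_one fun a _ => ?_
  simp only [Equiv.ofBijective_apply, φ]
  rw [Finset.prod_congr rfl fun (x : Subgroup.zpowers t) _ => hz x x.2 a.out, Finset.prod_const,
    Finset.card_univ, Fintype.card_zpowers, hC]

/-! ### Central extensions and equivariant permutations -/

/-- A central extension `C → G → Q` of groups together with a set-theoretic section `s` and the
resulting projection `r` to `C`. -/
structure CentralSection (C G Q : Type*) [CommGroup C] [Group G] [Group Q] where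
  /-- the inclusion of the central subgroup -/
  i : C →* G
  /-- the projection to the quotient -/
  π : G →* Q
  /-- the section -/
  s : Q → G
  /-- the component in the central subgroup -/
  r : G → C
  i_injective : Function.Injective i
  central : ∀ c g, i c * g = g * i c
  π_i : ∀ c, π (i c) = 1
  π_s : ∀ q, π (s q) = q
  s_mul_r : ∀ g, s (π g) * i (r g) = g

namespace CentralSection

variable {C G Q : Type*} [CommGroup C] [Group G] [Group Q] (S : CentralSection C G Q)

@[simp] theorem π_mul_i (g : G) (c : C) : S.π (g * S.i c) = S.π g := by simp [S.π_i]

@[simp] theorem r_mul_i (g : G) (c : C) : S.r (g * S.i c) = S.r g * c := by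
  apply S.i_injective
  have h := S.s_mul_r (g * S.i c)
  rw [π_mul_i] at h
  refine mul_left_cancel (h.trans ?_)
  rw [map_mul, ← mul_assoc, S.s_mul_r]

@[simp] theorem r_s (q : Q) : S.r (S.s q) = 1 := by
  apply S.i_injective
  have h := S.s_mul_r (S.s q)
  rw [S.π_s] at h
  simpa using h

theorem eq_mul_i_of_π_eq {g h : G} (e : S.π g = S.π h) : g = h * S.i ((S.r h)⁻¹ * S.r g) := by
  rw [map_mul, ← mul_assoc]
  nth_rw 1 [← S.s_mul_r g]
  congr 1
  rw [e]
  nth_rw 2 [← S.s_mul_r h]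
  simp [mul_assoc]

/-- The bijection `Q × C ≃ G` given by the section. -/
@[simps]
def prodEquiv : Q × C ≃ G where
  toFun x := S.s x.1 * S.i x.2
  invFun g := (S.π g, S.r g)
  left_inv x := by simp [S.π_s]
  right_inv g := S.s_mul_r g

theorem mem_range_i_iff (g : G) : g ∈ S.i.range ↔ S.π g = 1 := by
  constructor
  · rintro ⟨c, rfl⟩
    exact S.π_i c
  · intro h
    have := S.eq_mul_i_of_π_eq (g := g) (h := 1) (by simpa using h)
    rw [one_mul] at this
    exact ⟨_, this.symm⟩

/-- The permutations of `G` that commute with multiplication by the central subgroup. -/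
def equivariantPerm : Subgroup (Equiv.Perm G) where
  carrier := {τ | ∀ g c, τ (g * S.i c) = τ g * S.i c}
  one_mem' _ _ := rfl
  mul_mem' {σ τ} hσ hτ g c := by
    change σ (τ (g * S.i c)) = σ (τ g) * S.i c
    rw [hτ, hσ]
  inv_mem' {τ} hτ g c := by
    change τ.symm (g * S.i c) = τ.symm g * S.i c
    rw [Equiv.symm_apply_eq, hτ, Equiv.apply_symm_apply]

variable {S}

theorem equivariantPerm_apply (τ : S.equivariantPerm) (g : G) (c : C) :
    (τ : Equiv.Perm G) (g * S.i c) = (τ : Equiv.Perm G) g * S.i c := τ.2 g c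

theorem equivariantPerm_π_congr (τ : S.equivariantPerm) {g h : G} (e : S.π g = S.π h) :
    S.π ((τ : Equiv.Perm G) g) = S.π ((τ : Equiv.Perm G) h) := by
  rw [S.eq_mul_i_of_π_eq e, equivariantPerm_apply, π_mul_i]

variable (S)

/-- The permutation of the quotient induced by an equivariant permutation. -/
def quotientPerm : S.equivariantPerm →* Equiv.Perm Q where
  toFun τ :=
    { toFun := fun q => S.π ((τ : Equiv.Perm G) (S.s q))
      invFun := fun q => S.π (((τ⁻¹ : S.equivariantPerm) : Equiv.Perm G) (S.s q))
      left_inv := fun q => by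
        change S.π _ = q
        rw [equivariantPerm_π_congr τ⁻¹ (S.π_s _)]
        simp [S.π_s]
      right_inv := fun q => by
        change S.π _ = q
        rw [equivariantPerm_π_congr τ (S.π_s _)]
        simp [S.π_s] }
  map_one' := by ext q; simp [S.π_s]
  map_mul' σ τ := by
    ext q
    exact (equivariantPerm_π_congr σ (S.π_s _)).symm

theorem quotientPerm_apply (τ : S.equivariantPerm) (q : Q) :
    S.quotientPerm τ q = S.π ((τ : Equiv.Perm G) (S.s q)) := rfl

theorem quotientPerm_π (τ : S.equivariantPerm) (g : G) :
    S.quotientPerm τ (S.π g) = S.π ((τ : Equiv.Perm G) g) :=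
  equivariantPerm_π_congr τ (S.π_s _)

/-- Equivariant permutations of `G` are monomial matrices over `C` indexed by `Q`. -/
def equivariantPermEquiv : S.equivariantPerm ≃ Equiv.Perm Q × (Q → C) where
  toFun τ := (S.quotientPerm τ, fun q => S.r ((τ : Equiv.Perm G) (S.s q)))
  invFun x :=
    ⟨{ toFun := fun g => S.s (x.1 (S.π g)) * S.i (x.2 (S.π g) * S.r g)
       invFun := fun g => S.s (x.1.symm (S.π g)) * S.i ((x.2 (x.1.symm (S.π g)))⁻¹ * S.r g)
       left_inv := fun g => by
         simp only [π_mul_i, r_mul_i, S.π_s, r_s, one_mul, Equiv.symm_apply_apply,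
           inv_mul_cancel_left, S.s_mul_r]
       right_inv := fun g => by
         simp only [π_mul_i, r_mul_i, S.π_s, r_s, one_mul, Equiv.apply_symm_apply,
           mul_inv_cancel_left, S.s_mul_r] },
     fun g c => by simp [mul_assoc]⟩
  left_inv τ := by
    ext g
    simp only [Equiv.coe_fn_mk, quotientPerm_π, map_mul]
    conv_rhs => rw [← S.s_mul_r g, equivariantPerm_apply, ← S.s_mul_r ((τ : Equiv.Perm G) (S.s _))]
    rw [← quotientPerm_apply, quotientPerm_π, mul_assoc]
  right_inv x := by
    ext q <;> simp [quotientPerm_apply, S.π_s]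

theorem s_quotientPerm_mul (τ : S.equivariantPerm) (q : Q) :
    S.s (S.quotientPerm τ q) * S.i (S.r ((τ : Equiv.Perm G) (S.s q))) = (τ : Equiv.Perm G) (S.s q) :=
  S.s_mul_r _

/-- Right multiplication by elements of `G`, as equivariant permutations. -/
def rightMul : G →* S.equivariantPerm where
  toFun h := ⟨Equiv.mulRight h⁻¹, fun g c => by
    simp [mul_assoc, S.central]⟩
  map_one' := by ext; simp
  map_mul' h k := by ext; simp [mul_assoc]

@[simp] theorem rightMul_apply (h g : G) : (S.rightMul h : Equiv.Perm G) g = g * h⁻¹ := rfl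

@[simp] theorem rightMul_inv_apply (h g : G) :
    (S.rightMul h : Equiv.Perm G).symm g = g * h := by
  rw [Equiv.symm_apply_eq]; simp

/-- As `h` has prime order and lies outside the central subgroup, the two generate a direct product
`K`. On each left coset of `K`, `e` reads off the central coordinate relative to a chosen
representative. -/
theorem exists_equivariant_invariant {p : ℕ} (hp : p.Prime) (hG : ∀ g : G, g ^ p = 1) (h : G)
    (hh : h ∉ S.i.range) :
    ∃ e : G → C, (∀ g c, e (g * S.i c) = e g * c) ∧ ∀ g, e (g * h) = e g := by
  have hcop : ∀ n : ℤ, h ^ n ∈ S.i.range → h ^ n = 1 := by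
    intro n hn
    have hp' : Prime (p : ℤ) := Nat.prime_iff_prime_int.1 hp
    by_cases hd : (p : ℤ) ∣ n
    · obtain ⟨m, rfl⟩ := hd
      rw [zpow_mul, zpow_natCast, hG, one_zpow]
    -- By Bézout, `h` is itself a power of `h ^ n`.
    · obtain ⟨a, b, hab⟩ := (hp'.coprime_iff_not_dvd).2 hd
      exfalso
      apply hh
      have : h = (h ^ n) ^ b := by
        rw [← zpow_mul, mul_comm, ← one_mul (h ^ (b * n)), ← one_zpow a, ← hG h, ← zpow_natCast,
          ← zpow_mul, mul_comm (p : ℤ), ← zpow_add, hab, zpow_one]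
      rw [this]
      exact Subgroup.zpow_mem _ hn b
  have hinj : ∀ (c c' : C) (m n : ℤ), S.i c * h ^ m = S.i c' * h ^ n → c = c' := by
    intro c c' m n e
    have e' : S.i (c'⁻¹ * c) = h ^ (n - m) := by
      rw [map_mul, map_inv, zpow_sub, inv_mul_eq_iff_eq_mul, ← mul_assoc, ← e]
      simp
    have h1 := hcop (n - m) ⟨_, e'⟩
    rw [h1, ← map_one S.i] at e'
    exact (inv_mul_eq_one.1 (S.i_injective e')).symm
  let K : Subgroup G :=
    { carrier := {g | ∃ (c : C) (n : ℤ), g = S.i c * h ^ n}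
      one_mem' := ⟨1, 0, by simp⟩
      mul_mem' := by
        rintro _ _ ⟨c, n, rfl⟩ ⟨d, m, rfl⟩
        refine ⟨c * d, n + m, ?_⟩
        rw [map_mul, zpow_add, mul_assoc, ← mul_assoc _ (S.i d), ← S.central]
        simp only [mul_assoc]
      inv_mem' := by
        rintro _ ⟨c, n, rfl⟩
        refine ⟨c⁻¹, -n, ?_⟩
        rw [S.central]
        simp }
  have hex : ∀ g : G, ∃ (c : C) (n : ℤ), g = (g : G ⧸ K).out * (S.i c * h ^ n) := by
    intro g
    obtain ⟨c, n, e⟩ : (g : G ⧸ K).out⁻¹ * g ∈ K := QuotientGroup.eq.1 (QuotientGroup.out_eq' _)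
    exact ⟨c, n, by rw [← e]; simp⟩
  choose e n hen using hex
  have huniq : ∀ (g : G) (c : C) (m : ℤ), g = (g : G ⧸ K).out * (S.i c * h ^ m) → e g = c := by
    intro g c m hg
    exact hinj _ _ _ _ (mul_left_cancel ((hen g).symm.trans hg))
  refine ⟨e, fun g c => huniq _ _ (n g) ?_, fun g => huniq _ _ (n g + 1) ?_⟩
  · have : ((g * S.i c : G) : G ⧸ K) = g := QuotientGroup.mk_mul_of_mem _ ⟨c, 0, by simp⟩
    rw [this]
    nth_rw 1 [hen g]
    rw [map_mul, mul_assoc, mul_assoc, mul_assoc, ← S.central c (h ^ n g)]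
  · have : ((g * h : G) : G ⧸ K) = g := QuotientGroup.mk_mul_of_mem _ ⟨1, 1, by simp⟩
    rw [this]
    nth_rw 1 [hen g]
    rw [zpow_add, zpow_one]
    simp only [mul_assoc]

variable [Fintype Q]

/-- The product of the entries of the monomial matrix of an equivariant permutation. -/
def deg : S.equivariantPerm →* C where
  toFun τ := ∏ q, S.r ((τ : Equiv.Perm G) (S.s q))
  map_one' := by simp
  map_mul' σ τ := by
    have h : ∀ q, S.r (((σ * τ : S.equivariantPerm) : Equiv.Perm G) (S.s q)) =
        S.r ((σ : Equiv.Perm G) (S.s (S.quotientPerm τ q))) * S.r ((τ : Equiv.Perm G) (S.s q)) := by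
      intro q
      rw [← r_mul_i, ← equivariantPerm_apply, s_quotientPerm_mul]
      rfl
    rw [Finset.prod_congr rfl fun q _ => h q, Finset.prod_mul_distrib,
      Equiv.prod_comp (S.quotientPerm τ) fun q => S.r ((σ : Equiv.Perm G) (S.s q))]

theorem deg_apply (τ : S.equivariantPerm) : S.deg τ = ∏ q, S.r ((τ : Equiv.Perm G) (S.s q)) := rfl

/-- The degree may be computed from any `C`-equivariant function in place of `r`. -/
theorem deg_eq_prod_div (τ : S.equivariantPerm) (e : G → C)
    (he : ∀ g c, e (g * S.i c) = e g * c) :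
    S.deg τ = ∏ q, e ((τ : Equiv.Perm G) (S.s q)) / e (S.s q) := by
  have h : ∀ q, e ((τ : Equiv.Perm G) (S.s q)) =
      e (S.s (S.quotientPerm τ q)) * S.r ((τ : Equiv.Perm G) (S.s q)) := by
    intro q
    rw [← he, s_quotientPerm_mul]
  rw [Finset.prod_div_distrib, Finset.prod_congr rfl fun q _ => h q, Finset.prod_mul_distrib,
    Equiv.prod_comp (S.quotientPerm τ) fun q => e (S.s q), mul_div_cancel_left, deg_apply]

/-- In exponent `p`, an equivariant permutation that commutes with right multiplication by an
element outside the central subgroup has trivial degree. -/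
theorem deg_eq_one_of_commute {p : ℕ} (hp : p.Prime) (hG : ∀ g : G, g ^ p = 1) (h : G)
    (hh : h ∉ S.i.range) (τ : S.equivariantPerm)
    (hτ : ∀ g, (τ : Equiv.Perm G) (g * h) = (τ : Equiv.Perm G) g * h) : S.deg τ = 1 := by
  obtain ⟨e, he, heh⟩ := S.exists_equivariant_invariant hp hG h hh
  rw [S.deg_eq_prod_div τ e he]
  have ho : orderOf (S.π h) = p := by
    have : Fact p.Prime := ⟨hp⟩
    refine orderOf_eq_prime (by rw [← map_pow, hG, map_one]) fun h1 => hh ?_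
    rwa [mem_range_i_iff]
  -- Passing from `q` to `q * π h` changes the representative by `h`, which `e` ignores, and by a
  -- central factor, which cancels in the quotient.
  refine prod_eq_one_of_mul_right_invariant _ (S.π h) (fun q => ?_) fun c => ?_
  · obtain ⟨c, hc⟩ : ∃ c, S.s (q * S.π h) = S.s q * h * S.i c :=
      ⟨_, S.eq_mul_i_of_π_eq (by simp [S.π_s])⟩
    rw [hc, equivariantPerm_apply, he, he, hτ, heh, heh, mul_div_mul_right_eq_div]
  · apply S.i_injective
    rw [ho, map_pow, hG, map_one]

end CentralSection

/-! ### Group matrices and the determinant modulo `p` -/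

theorem groupDet_eq_det {G : Type*} [Group G] [Fintype G] [DecidableEq G]
    (F : MonoidAlgebra ℤ G) :
    groupDet F = (Matrix.of fun g h : G => F.coeff (g * h⁻¹)).det := by
  unfold groupDet
  convert rfl

/-- The group matrix `(a_{g h⁻¹})` of an element of a group algebra, as an algebra homomorphism. -/
noncomputable def groupMatrixHom (R C : Type*) [CommRing R] [Group C] [Fintype C] [DecidableEq C] :
    MonoidAlgebra R C →ₐ[R] Matrix C C R :=
  MonoidAlgebra.lift R (Matrix C C R) C
    { toFun := fun c => Matrix.of fun g h => if g * h⁻¹ = c then 1 else 0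
      map_one' := by
        ext g h
        simp [Matrix.one_apply, mul_inv_eq_one]
      map_mul' := fun c d => by
        ext g h
        have h1 : ∀ x : C, g * x⁻¹ = c ↔ x = c⁻¹ * g := fun x => by
          rw [mul_inv_eq_iff_eq_mul, eq_inv_mul_iff_mul_eq, eq_comm]
        have h2 : c⁻¹ * g * h⁻¹ = d ↔ g * h⁻¹ = c * d := by
          rw [mul_assoc, inv_mul_eq_iff_eq_mul]
        simp only [Matrix.mul_apply, Matrix.of_apply, h1, ite_mul, one_mul, zero_mul,
          Finset.sum_ite_eq', Finset.mem_univ, if_true, h2] }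

@[simp] theorem groupMatrixHom_apply {R C : Type*} [CommRing R] [Group C] [Fintype C]
    [DecidableEq C] (D : MonoidAlgebra R C) (g h : C) :
    groupMatrixHom R C D g h = D.coeff (g * h⁻¹) := by
  rw [groupMatrixHom, MonoidAlgebra.lift_apply, Finsupp.sum_fintype _ _ (by simp),
    Matrix.sum_apply]
  simp

/-- The group determinant modulo `p` of a commutative group of exponent `p`. -/
theorem groupDet_modEq_prime {p : ℕ} [Fact p.Prime] {C : Type*} [CommGroup C] [Fintype C]
    (hC : ∀ c : C, c ^ p = 1) (D : MonoidAlgebra ℤ C) :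
    groupDet D ≡ (∑ c, D.coeff c) ^ Fintype.card C [ZMOD p] := by
  classical
  rw [groupDet_eq_det, ← ZMod.intCast_eq_intCast_iff, Int.cast_det]
  let E : MonoidAlgebra (ZMod p) C := ∑ c, MonoidAlgebra.single c (D.coeff c : ZMod p)
  have hE : (Matrix.of fun g h : C => D.coeff (g * h⁻¹)).map (Int.cast : ℤ → ZMod p) =
      groupMatrixHom (ZMod p) C E := by
    ext g h
    simp [E, Finsupp.single_apply]
  have hchar : CharP (MonoidAlgebra (ZMod p) C) p :=
    charP_of_injective_algebraMap (algebraMap (ZMod p) (MonoidAlgebra (ZMod p) C)).injective p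
  have hpow : E ^ p = algebraMap (ZMod p) _ (∑ c, (D.coeff c : ZMod p)) := by
    simp only [E]
    rw [sum_pow_char, map_sum]
    refine Finset.sum_congr rfl fun c _ => ?_
    rw [MonoidAlgebra.single_pow, hC, ZMod.pow_card]
    rfl
  -- The determinant lies in `ZMod p`, so it equals its own `p`-th power, the determinant of the
  -- scalar matrix coming from `E ^ p`.
  rw [hE, ← ZMod.pow_card (Matrix.det _), ← Matrix.det_pow, ← map_pow, hpow, AlgHom.commutes,
    Matrix.algebraMap_eq_diagonal]
  simp

/-! ### The determinant over the central group ring -/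

namespace CentralSection

variable {C G Q : Type*} [CommGroup C] [Group G] [Group Q]

theorem card_eq_mul (S : CentralSection C G Q) : Nat.card G = Nat.card Q * Nat.card C := by
  rw [← Nat.card_prod, Nat.card_congr S.prodEquiv]

section Weight

variable (S : CentralSection C G Q) [Fintype Q] [DecidableEq Q]

/-- The contribution of an equivariant permutation to the determinant of the block matrix. -/
noncomputable def weight (F : MonoidAlgebra ℤ G) (τ : S.equivariantPerm) : ℤ :=
  (Equiv.Perm.sign (S.quotientPerm τ) : ℤ) *
    ∏ q, F.coeff ((τ : Equiv.Perm G) (S.s q) * (S.s q)⁻¹)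

/-- The ratio `τ g * g⁻¹` depends only on the class of `g` in `Q`, so conjugation merely translates
the index of the product by `π h`. -/
theorem weight_conj (F : MonoidAlgebra ℤ G) (h : G) (τ : S.equivariantPerm) :
    S.weight F (S.rightMul h * τ * (S.rightMul h)⁻¹) = S.weight F τ := by
  have hinv : ∀ g g' : G, S.π g = S.π g' → (τ : Equiv.Perm G) g * g⁻¹ = (τ : Equiv.Perm G) g' * g'⁻¹ := by
    intro g g' e
    rw [S.eq_mul_i_of_π_eq e, equivariantPerm_apply, mul_inv_rev, mul_assoc, mul_inv_cancel_left]
  have h1 : ∀ q, ((S.rightMul h * τ * (S.rightMul h)⁻¹ : S.equivariantPerm) : Equiv.Perm G) (S.s q) *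
      (S.s q)⁻¹ = (τ : Equiv.Perm G) (S.s (q * S.π h)) * (S.s (q * S.π h))⁻¹ := by
    intro q
    rw [hinv _ (S.s q * h) (by simp [S.π_s])]
    simp [mul_assoc]
  unfold weight
  congr 1
  · rw [map_mul, map_mul, map_inv, map_mul, map_mul, map_inv, mul_inv_cancel_comm]
  · simp only [h1]
    exact Equiv.prod_comp (Equiv.mulRight (S.π h)) fun q =>
      F.coeff ((τ : Equiv.Perm G) (S.s q) * (S.s q)⁻¹)

end Weight

variable (S : CentralSection C G Q) [Fintype C]

/-- The matrix of right multiplication by an element of `ℤ[G]` over the central subring `ℤ[C]`. -/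
noncomputable def blockMatrix (F : MonoidAlgebra ℤ G) : Matrix Q Q (MonoidAlgebra ℤ C) :=
  Matrix.of fun q q' => ∑ c, MonoidAlgebra.single c (F.coeff (S.s q * S.i c * (S.s q')⁻¹))

theorem blockMatrix_apply (F : MonoidAlgebra ℤ G) (q q' : Q) : S.blockMatrix F q q' =
    ∑ c, MonoidAlgebra.single c (F.coeff (S.s q * S.i c * (S.s q')⁻¹)) := rfl

@[simp] theorem coeff_blockMatrix (F : MonoidAlgebra ℤ G) (q q' : Q) (c : C) :
    (S.blockMatrix F q q').coeff c = F.coeff (S.s q * S.i c * (S.s q')⁻¹) := by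
  classical
  simp [blockMatrix_apply, Finsupp.single_apply]

variable [Fintype Q]

/-- The pushforward of a group ring element to the quotient. -/
noncomputable def push (F : MonoidAlgebra ℤ G) : MonoidAlgebra ℤ Q :=
  ∑ q, MonoidAlgebra.single q (∑ c, F.coeff (S.s q * S.i c))

theorem coeff_push (F : MonoidAlgebra ℤ G) (g : G) :
    (S.push F).coeff (S.π g) = ∑ c, F.coeff (g * S.i c) := by
  classical
  simp only [push, MonoidAlgebra.coeff_sum, MonoidAlgebra.coeff_single, Finsupp.coe_finsetSum,
    Finset.sum_apply, Finsupp.single_apply, Finset.sum_ite_eq', Finset.mem_univ, if_true]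
  rw [← Equiv.sum_comp (Equiv.mulLeft (S.r g))]
  refine Finset.sum_congr rfl fun c _ => ?_
  rw [Equiv.coe_mulLeft, map_mul S.i, ← mul_assoc, S.s_mul_r]

theorem sum_coeff_push [Fintype G] (F : MonoidAlgebra ℤ G) :
    ∑ q, (S.push F).coeff q = ∑ g, F.coeff g := by
  rw [← Equiv.sum_comp S.prodEquiv, Fintype.sum_prod_type]
  refine Finset.sum_congr rfl fun q _ => ?_
  rw [← S.π_s q, coeff_push, S.π_s]
  rfl

variable [DecidableEq Q]

/-- Transitivity of determinants: replacing each entry by its group matrix over `C` gives the group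
matrix of `F`, reindexed by `prodEquiv`. -/
theorem groupDet_det_blockMatrix [Fintype G] (F : MonoidAlgebra ℤ G) :
    groupDet (S.blockMatrix F).det = groupDet F := by
  classical
  have h1 : groupDet (S.blockMatrix F).det =
      ((groupMatrixHom ℤ C : MonoidAlgebra ℤ C →+* Matrix C C ℤ) (S.blockMatrix F).det).det := by
    rw [groupDet_eq_det]
    congr 1
    ext g h
    simp
  rw [h1, Matrix.det_det, groupDet_eq_det,
    ← Matrix.det_submatrix_equiv_self S.prodEquiv (Matrix.of _)]
  congr 1
  ext ⟨q, c⟩ ⟨q', c'⟩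
  simp [mul_assoc]

theorem sum_coeff_det_blockMatrix (F : MonoidAlgebra ℤ G) :
    ∑ c, (S.blockMatrix F).det.coeff c = groupDet (S.push F) := by
  let ε : MonoidAlgebra ℤ C →+* ℤ := (MonoidAlgebra.lift ℤ ℤ C 1 : MonoidAlgebra ℤ C →ₐ[ℤ] ℤ)
  have hε : ∀ D, ε D = ∑ c, D.coeff c := fun D => by
    simp [ε, MonoidAlgebra.lift_apply, Finsupp.sum_fintype]
  rw [← hε, RingHom.map_det, groupDet_eq_det]
  congr 1
  ext q q'
  have h : q * q'⁻¹ = S.π (S.s q * (S.s q')⁻¹) := by simp [S.π_s]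
  rw [RingHom.mapMatrix_apply, Matrix.map_apply, hε, Matrix.of_apply, h, coeff_push]
  refine Finset.sum_congr rfl fun c _ => ?_
  rw [coeff_blockMatrix, mul_assoc, S.central, mul_assoc]

noncomputable instance [Finite G] : Fintype S.equivariantPerm := Fintype.ofFinite _

/-- Expanding each product of entries chooses an element of `C` for every `q`; a permutation of `Q`
with such a choice is exactly an equivariant permutation. -/
theorem det_blockMatrix [Finite G] (F : MonoidAlgebra ℤ G) : (S.blockMatrix F).det =
    ∑ τ : S.equivariantPerm, MonoidAlgebra.single (S.deg τ) (S.weight F τ) := by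
  classical
  rw [Matrix.det_apply, ← Equiv.sum_comp S.equivariantPermEquiv.symm, Fintype.sum_prod_type]
  refine Finset.sum_congr rfl fun σ _ => ?_
  simp only [blockMatrix_apply]
  rw [Finset.prod_univ_sum, Fintype.piFinset_univ, Finset.smul_sum]
  refine Finset.sum_congr rfl fun f _ => ?_
  set τ := S.equivariantPermEquiv.symm (σ, f) with hτ
  have hστ : S.equivariantPermEquiv τ = (σ, f) := by simp [hτ]
  have h1 : S.quotientPerm τ = σ := congrArg Prod.fst hστ
  have h2 : ∀ q, S.r ((τ : Equiv.Perm G) (S.s q)) = f q := fun q => congrFun (congrArg Prod.snd hστ) q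
  have h3 : ∀ q, S.s (σ q) * S.i (f q) = (τ : Equiv.Perm G) (S.s q) := fun q => by
    rw [← h1, ← h2, s_quotientPerm_mul]
  have h4 : ∀ (t : Finset Q) (a : Q → C) (b : Q → ℤ), ∏ q ∈ t, MonoidAlgebra.single (a q) (b q) =
      MonoidAlgebra.single (∏ q ∈ t, a q) (∏ q ∈ t, b q) := fun t a b => by
    induction t using Finset.induction_on with
    | empty => simp [MonoidAlgebra.one_def]
    | insert q t hq ih => simp [Finset.prod_insert hq, ih, MonoidAlgebra.single_mul_single]
  rw [h4, weight, h1, deg_apply]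
  simp only [h2, h3, Units.smul_def, MonoidAlgebra.smul_single, smul_eq_mul]

/-- In exponent `p`, the coefficients of the block determinant away from the identity are divisible
by the order of the quotient. -/
theorem dvd_coeff_det_blockMatrix [Finite G] {p : ℕ} (hp : p.Prime) (hG : ∀ g : G, g ^ p = 1)
    (F : MonoidAlgebra ℤ G) (c : C) (hc : c ≠ 1) :
    (Nat.card Q : ℤ) ∣ (S.blockMatrix F).det.coeff c := by
  classical
  let _ : MulAction G S.equivariantPerm :=
    MulAction.compHom S.equivariantPerm ((MulAut.conj (G := S.equivariantPerm)).comp S.rightMul)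
  have hsmul : ∀ (g : G) (τ : S.equivariantPerm),
      g • τ = S.rightMul g * τ * (S.rightMul g)⁻¹ := fun _ _ => rfl
  rw [det_blockMatrix, MonoidAlgebra.coeff_sum, Finsupp.finsetSum_apply]
  simp only [MonoidAlgebra.coeff_single, Finsupp.single_apply]
  refine MulAction.dvd_sum_of_dvd_card_orbit (G := G) _ (fun g τ => ?_) _ fun τ hτ => ?_
  · rw [hsmul, weight_conj]
    simp [mul_comm]
  · have hdeg : S.deg τ = c := by
      by_contra h
      simp [h] at hτ
    have hstab : MulAction.stabilizer G τ ≤ S.i.range := by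
      intro h hh
      by_contra hr
      refine hc (hdeg ▸ S.deg_eq_one_of_commute hp hG h hr τ fun g => ?_)
      have e : S.rightMul h * τ * (S.rightMul h)⁻¹ = τ := hh
      rw [mul_inv_eq_iff_eq_mul] at e
      have e' := congrArg (fun x : S.equivariantPerm => (x : Equiv.Perm G) (g * h)) e
      simp at e'
      rw [← e']
      simp
    -- Since `|G| = |Q| * |C|`, the orbit size is `|Q|` times the index of the stabilizer in `C`.
    have hcard : Nat.card (MulAction.stabilizer G τ) ∣ Nat.card C := by
      rw [Nat.card_congr (MonoidHom.ofInjective S.i_injective).toEquiv]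
      exact Subgroup.card_dvd_of_le hstab
    have hmul := (MulAction.stabilizer G τ).index_mul_card
    rw [MulAction.index_stabilizer, S.card_eq_mul] at hmul
    obtain ⟨k, hk⟩ := hcard
    refine ⟨k, Nat.eq_of_mul_eq_mul_right (Nat.card_pos (α := MulAction.stabilizer G τ)) ?_⟩
    rw [Nat.card_coe_set_eq, hmul, hk]
    ring

end CentralSection

/-! ### Induction on the order of the group -/

open scoped IsMulCommutative

/-- The cofactor of `a - b` in `a ^ p - b ^ p` is a sum of `p` terms all congruent modulo `p`; `n ≠
0` ensures `a ≡ b` modulo `p`. -/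
theorem Int.ModEq.pow_prime_pow_succ {p n : ℕ} {a b : ℤ} (hn : n ≠ 0)
    (h : a ≡ b [ZMOD (p : ℤ) ^ n]) : a ^ p ≡ b ^ p [ZMOD (p : ℤ) ^ (n + 1)] := by
  have h' := Int.modEq_iff_dvd.1 h
  rw [Int.modEq_iff_dvd, ← geom_sum₂_mul, pow_succ']
  refine mul_dvd_mul ?_ h'
  have hab : ((a : ℤ) : ZMod p) = b :=
    (ZMod.intCast_eq_intCast_iff _ _ _).2 (h.of_dvd (dvd_pow_self _ hn))
  rw [← ZMod.intCast_zmod_eq_zero_iff_dvd]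
  simp [hab, geom_sum₂_self]

/-- The central extension given by a central subgroup and an arbitrary section. -/
noncomputable def CentralSection.ofCentral {G : Type*} [Group G] {z : G}
    (hz : z ∈ Subgroup.center G) [(Subgroup.zpowers z).Normal] :
    CentralSection (Subgroup.zpowers z) G (G ⧸ Subgroup.zpowers z) where
  i := (Subgroup.zpowers z).subtype
  π := QuotientGroup.mk' _
  s := Quotient.out
  r g := ⟨(g : G ⧸ Subgroup.zpowers z).out⁻¹ * g, QuotientGroup.eq.1 (QuotientGroup.out_eq' _)⟩
  i_injective := Subtype.val_injective
  central c g := (Subgroup.mem_center_iff.1 ((Subgroup.zpowers_le.2 hz) c.2) g).symm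
  π_i c := (QuotientGroup.eq_one_iff _).2 c.2
  π_s := QuotientGroup.out_eq'
  s_mul_r g := by simp

/-- The group determinant of a `p`-group of exponent `p` is congruent to the corresponding power
of the sum of the coefficients modulo the order of the group. -/
theorem groupDet_modEq_of_exponent {p : ℕ} [hp : Fact p.Prime] (n : ℕ) :
    ∀ (G : Type*) [Group G] [Fintype G], Nat.card G = p ^ n → (∀ g : G, g ^ p = 1) →
      ∀ F : MonoidAlgebra ℤ G, groupDet F ≡ (∑ g, F.coeff g) ^ p ^ n [ZMOD (p : ℤ) ^ n] := by
  classical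
  induction n with
  | zero => intros; simp [Int.modEq_one]
  | succ n ih =>
    intro G _ _ hcard hG F
    have hpG : IsPGroup p G := IsPGroup.of_card hcard
    have : Nontrivial G := by
      rw [← Finite.one_lt_card_iff_nontrivial, hcard]
      exact Nat.one_lt_pow (by omega) hp.out.one_lt
    have := hpG.center_nontrivial
    obtain ⟨⟨z, hz⟩, hz1⟩ := exists_ne (1 : Subgroup.center G)
    have hz1' : z ≠ 1 := fun h => hz1 (Subtype.ext h)
    have ho : orderOf z = p := orderOf_eq_prime (hG z) hz1'
    have : (Subgroup.zpowers z).Normal := 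
      ⟨fun x hx g => by
        rwa [Subgroup.mem_center_iff.1 (Subgroup.zpowers_le.2 hz hx) g, mul_inv_cancel_right]⟩
    let S := CentralSection.ofCentral hz
    have hC : Nat.card (Subgroup.zpowers z) = p := by rw [Nat.card_zpowers, ho]
    have hQ : Nat.card (G ⧸ Subgroup.zpowers z) = p ^ n := by
      have h := S.card_eq_mul
      rw [hcard, hC, pow_succ] at h
      exact (Nat.eq_of_mul_eq_mul_right hp.out.pos h).symm
    have hQe : ∀ q : G ⧸ Subgroup.zpowers z, q ^ p = 1 := fun q => by
      rw [← S.π_s q, ← map_pow, hG, map_one]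
    have hCe : ∀ c : Subgroup.zpowers z, c ^ p = 1 := fun c => Subtype.ext (hG c)
    set Δ := (S.blockMatrix F).det with hΔ
    have hsum : ∑ c, Δ.coeff c ≡ (∑ g, F.coeff g) ^ p ^ n [ZMOD (p : ℤ) ^ n] := by
      rw [hΔ, S.sum_coeff_det_blockMatrix, ← S.sum_coeff_push]
      exact ih _ hQ hQe _
    have hdvd : ∀ c ≠ 1, (p : ℤ) ^ n ∣ Δ.coeff c := fun c hc => by
      have := S.dvd_coeff_det_blockMatrix hp.out hG F c hc
      rwa [hQ, Nat.cast_pow] at this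
    rw [← S.groupDet_det_blockMatrix F, ← hΔ]
    -- For `n = 0` the divisibility by `p ^ n` is void, so order `p` is settled by Frobenius
    -- instead.
    rcases Nat.eq_zero_or_pos n with rfl | hn
    · have h := groupDet_modEq_prime hCe Δ
      rw [hΔ, S.sum_coeff_det_blockMatrix, ← hΔ, ← Nat.card_eq_fintype_card, hC] at h
      have hQ1 : Subsingleton (G ⧸ Subgroup.zpowers z) :=
        (Nat.card_eq_one_iff_unique.1 (by simpa using hQ)).1
      have h2 : groupDet (S.push F) = ∑ g, F.coeff g := by
        rw [← S.sum_coeff_push, groupDet_eq_det, Matrix.det_eq_elem_of_subsingleton _ 1,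
          Fintype.sum_subsingleton _ 1]
        simp
      simpa [h2] using h
    · have h1 : Δ.coeff 1 ≡ ∑ c, Δ.coeff c [ZMOD (p : ℤ) ^ n] := by
        rw [← Finset.add_sum_erase _ _ (Finset.mem_univ (1 : Subgroup.zpowers z))]
        refine Int.modEq_iff_dvd.2 ?_
        rw [add_sub_cancel_left]
        exact Finset.dvd_sum fun c hc => hdvd c (Finset.ne_of_mem_erase hc)
      have h2 : groupDet Δ ≡ Δ.coeff 1 ^ p [ZMOD (p : ℤ) ^ (n + 1)] := by
        rw [groupDet_eq_det]
        have h := Matrix.det_modEq_prod_diag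
          (Matrix.of fun g h : Subgroup.zpowers z => Δ.coeff (g * h⁻¹)) ((p : ℤ) ^ n)
          fun i j hij => hdvd _ fun e => hij (mul_inv_eq_one.1 e)
        simp only [Matrix.of_apply, mul_inv_cancel, Finset.prod_const, Finset.card_univ] at h
        rw [← Nat.card_eq_fintype_card, hC, ← pow_mul] at h
        -- Here `n + 1 ≤ 2 * n` because `n` is positive.
        exact h.of_dvd (pow_dvd_pow _ (by omega))
      refine h2.trans ?_
      rw [pow_succ p n, pow_mul]
      exact (h1.trans hsum).pow_prime_pow_succ hn.ne'

/-! ### Monomial coordinates; the Heisenberg group and `ℤ_p³` -/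

theorem groupRingPoly_spec {G : Type*} [Group G] [Finite G] {p : ℕ} [Fact p.Prime]
    (hG : ∀ g : G, g ^ p = 1) (x y z : G)
    (h : Function.Bijective fun t : Fin p × Fin p × Fin p =>
      x ^ (t.1 : ℕ) * y ^ (t.2.1 : ℕ) * z ^ (t.2.2 : ℕ)) (F : MonoidAlgebra ℤ G) :
    (∃! a : Fin p → Fin p → Fin p → ℤ, F = groupRingPoly x y z a) ∧
      ∀ a : Fin p → Fin p → Fin p → ℤ, F = groupRingPoly x y z a →
        groupDet F ≡ (∑ i : Fin p, ∑ j : Fin p, ∑ k : Fin p, a i j k) ^ (p ^ 3)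
          [ZMOD (p : ℤ) ^ 3] := by
  classical
  let _ := Fintype.ofFinite G
  let e := Equiv.ofBijective _ h
  have he : ∀ i j k, e (i, j, k) = x ^ (i : ℕ) * y ^ (j : ℕ) * z ^ (k : ℕ) := fun _ _ _ => rfl
  have hcoeff : ∀ (a : Fin p → Fin p → Fin p → ℤ) i j k,
      (groupRingPoly x y z a).coeff (e (i, j, k)) = a i j k := by
    intro a i j k
    have : groupRingPoly x y z a =
        ∑ t : Fin p × Fin p × Fin p, MonoidAlgebra.single (e t) (a t.1 t.2.1 t.2.2) := by
      simp only [groupRingPoly, Fintype.sum_prod_type, he]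
    rw [this]
    simp [Finsupp.single_apply]
  have hiff : ∀ a, F = groupRingPoly x y z a ↔ ∀ i j k, F.coeff (e (i, j, k)) = a i j k := by
    intro a
    constructor
    · rintro rfl
      exact hcoeff a
    · intro hF
      ext g
      obtain ⟨⟨i, j, k⟩, rfl⟩ := e.surjective g
      rw [hF, hcoeff]
  refine ⟨⟨fun i j k => F.coeff (e (i, j, k)), (hiff _).2 fun _ _ _ => rfl, fun b hb => ?_⟩,
    fun a ha => ?_⟩
  · ext i j k
    exact ((hiff b).1 hb i j k).symm
  · have hcard : Nat.card G = p ^ 3 := by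
      rw [← Nat.card_congr e]
      simp [pow_succ, mul_assoc]
    have := groupDet_modEq_of_exponent 3 G hcard hG F
    rw [← Equiv.sum_comp e] at this
    simpa only [Fintype.sum_prod_type, (hiff a).1 ha] using this

theorem heisenbergMk_mul {R : Type*} [CommRing R] (a b c a' b' c' : R) :
    heisenbergMk a b c * heisenbergMk a' b' c' =
      heisenbergMk (a + a') (b + b') (c + a * b' + c') := by
  apply Subtype.ext
  apply Subtype.ext
  change !![1, a, c; 0, 1, b; 0, 0, 1] * !![1, a', c'; 0, 1, b'; 0, 0, 1] =
    !![1, a + a', c + a * b' + c'; 0, 1, b + b'; 0, 0, 1]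
  ext i j
  fin_cases i <;> fin_cases j <;> simp [Matrix.mul_apply, Fin.sum_univ_three] <;> ring

theorem heisenbergMk_zero {R : Type*} [CommRing R] : heisenbergMk (0 : R) 0 0 = 1 := by
  apply Subtype.ext
  apply Subtype.ext
  change !![1, 0, 0; 0, 1, 0; 0, 0, 1] = (1 : Matrix (Fin 3) (Fin 3) R)
  exact Matrix.one_fin_three.symm

theorem heisenbergMk_pow {R : Type*} [CommRing R] (a b c : R) (n : ℕ) :
    heisenbergMk a b c ^ n = heisenbergMk (n * a) (n * b) (n * c + n.choose 2 * (a * b)) := by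
  induction n with
  | zero => simp [heisenbergMk_zero]
  | succ n ih =>
    rw [pow_succ, ih, heisenbergMk_mul, Nat.choose_succ_succ' n 1]
    congr 1 <;> push_cast [Nat.choose_one_right] <;> ring

theorem heisenbergMk_injective {R : Type*} [CommRing R] {a b c a' b' c' : R}
    (h : heisenbergMk a b c = heisenbergMk a' b' c') : a = a' ∧ b = b' ∧ c = c' := by
  have h' : !![1, a, c; 0, 1, b; 0, 0, 1] = !![1, a', c'; 0, 1, b'; 0, 0, 1] :=
    congrArg (fun x : heisenberg R => ((x : Matrix.SpecialLinearGroup (Fin 3) R) :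
      Matrix (Fin 3) (Fin 3) R)) h
  exact ⟨by simpa using congrFun (congrFun h' 0) 1, by simpa using congrFun (congrFun h' 1) 2,
    by simpa using congrFun (congrFun h' 0) 2⟩

theorem heisenbergMk_surjective {R : Type*} [CommRing R] (g : heisenberg R) :
    ∃ a b c, heisenbergMk a b c = g := by
  obtain ⟨A, a, b, c, hA⟩ := g
  exact ⟨a, b, c, Subtype.ext (Subtype.ext hA.symm)⟩

theorem heisenberg_pow_prime (p : ℕ) [hp : Fact p.Prime] (hp2 : p ≠ 2) (g : heisenberg (ZMod p)) :
    g ^ p = 1 := by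
  obtain ⟨a, b, c, rfl⟩ := heisenbergMk_surjective g
  -- Oddness of `p` enters here: it kills the commutator term of the `p`-th power.
  have h : ((p.choose 2 : ℕ) : ZMod p) = 0 := by
    rw [ZMod.natCast_eq_zero_iff]
    exact hp.out.dvd_choose_self two_ne_zero (lt_of_le_of_ne hp.out.two_le (Ne.symm hp2))
  rw [heisenbergMk_pow, h]
  simp [heisenbergMk_zero]

theorem Fin.natCast_zmod_bijective (p : ℕ) [NeZero p] :
    Function.Bijective fun i : Fin p => ((i : ℕ) : ZMod p) := by
  refine ⟨fun i j h => ?_, fun x => ⟨⟨x.val, x.val_lt⟩, ZMod.natCast_zmod_val x⟩⟩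
  have := (ZMod.natCast_eq_natCast_iff _ _ _).1 h
  exact Fin.ext (Nat.ModEq.eq_of_lt_of_lt this i.2 j.2)

theorem heisenberg_monomial_bijective (p : ℕ) [Fact p.Prime] :
    Function.Bijective fun t : Fin p × Fin p × Fin p =>
      heisenbergX (ZMod p) ^ (t.1 : ℕ) * heisenbergY (ZMod p) ^ (t.2.1 : ℕ) *
        heisenbergZ (ZMod p) ^ (t.2.2 : ℕ) := by
  -- With `x` to the left of `y` no commutator term appears. The exponent of `x` is the entry `b`
  -- and that of `y` the entry `a`, hence the swap.
  have h : ∀ i j k : ℕ, heisenbergX (ZMod p) ^ i * heisenbergY (ZMod p) ^ j *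
      heisenbergZ (ZMod p) ^ k = heisenbergMk (j : ZMod p) i k := fun i j k => by
    simp [heisenbergX, heisenbergY, heisenbergZ, heisenbergMk_pow, heisenbergMk_mul]
  have hb := Fin.natCast_zmod_bijective p
  simp only [h]
  constructor
  · rintro ⟨i, j, k⟩ ⟨i', j', k'⟩ e
    obtain ⟨h1, h2, h3⟩ := heisenbergMk_injective e
    exact Prod.ext (hb.1 h2) (Prod.ext (hb.1 h1) (hb.1 h3))
  · intro g
    obtain ⟨a, b, c, rfl⟩ := heisenbergMk_surjective g
    obtain ⟨i, rfl⟩ := hb.2 a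
    obtain ⟨j, rfl⟩ := hb.2 b
    obtain ⟨k, rfl⟩ := hb.2 c
    exact ⟨(j, i, k), rfl⟩

theorem zmodCube_monomial_bijective (p : ℕ) [Fact p.Prime] :
    Function.Bijective fun t : Fin p × Fin p × Fin p =>
      zmodCubeGen p 0 ^ (t.1 : ℕ) * zmodCubeGen p 1 ^ (t.2.1 : ℕ) *
        zmodCubeGen p 2 ^ (t.2.2 : ℕ) := by
  have h : ∀ i j k : ℕ, zmodCubeGen p 0 ^ i * zmodCubeGen p 1 ^ j * zmodCubeGen p 2 ^ k =
      Multiplicative.ofAdd ![(i : ZMod p), j, k] := fun i j k => by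
    simp only [zmodCubeGen, ← ofAdd_nsmul, ← ofAdd_add]
    congr 1
    ext l
    fin_cases l <;> simp
  have hb := Fin.natCast_zmod_bijective p
  simp only [h]
  constructor
  · rintro ⟨i, j, k⟩ ⟨i', j', k'⟩ e
    have e' := Multiplicative.ofAdd.injective e
    exact Prod.ext (hb.1 (congrFun e' 0)) (Prod.ext (hb.1 (congrFun e' 1)) (hb.1 (congrFun e' 2)))
  · intro g
    obtain ⟨v, rfl⟩ := Multiplicative.ofAdd.surjective g
    obtain ⟨i, hi⟩ := hb.2 (v 0)
    obtain ⟨j, hj⟩ := hb.2 (v 1)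
    obtain ⟨k, hk⟩ := hb.2 (v 2)
    refine ⟨(i, j, k), congrArg Multiplicative.ofAdd ?_⟩
    ext l
    fin_cases l
    exacts [hi, hj, hk]

theorem theorem3p1 (p : ℕ) [Fact p.Prime] (hp : p ≠ 2) :
    (∀ F : MonoidAlgebra ℤ (heisenberg (ZMod p)),
      (∃! a : Fin p → Fin p → Fin p → ℤ, F = groupRingPoly
        (heisenbergX (ZMod p)) (heisenbergY (ZMod p)) (heisenbergZ (ZMod p)) a) ∧
      ∀ a : Fin p → Fin p → Fin p → ℤ, F = groupRingPoly
        (heisenbergX (ZMod p)) (heisenbergY (ZMod p)) (heisenbergZ (ZMod p)) a →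
        groupDet F ≡ (∑ i : Fin p, ∑ j : Fin p, ∑ k : Fin p, a i j k) ^ (p ^ 3) [ZMOD (p : ℤ) ^ 3]) ∧
    (∀ F : MonoidAlgebra ℤ (ZModCube p),
      (∃! a : Fin p → Fin p → Fin p → ℤ, F = groupRingPoly
        (zmodCubeGen p 0) (zmodCubeGen p 1) (zmodCubeGen p 2) a) ∧
      ∀ a : Fin p → Fin p → Fin p → ℤ, F = groupRingPoly
        (zmodCubeGen p 0) (zmodCubeGen p 1) (zmodCubeGen p 2) a →
        groupDet F ≡ (∑ i : Fin p, ∑ j : Fin p, ∑ k : Fin p, a i j k) ^ (p ^ 3) [ZMOD (p : ℤ) ^ 3]) := by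
  refine ⟨groupRingPoly_spec (heisenberg_pow_prime p hp) _ _ _ (heisenberg_monomial_bijective p),
    groupRingPoly_spec (fun g => ?_) _ _ _ (zmodCube_monomial_bijective p)⟩
  apply Multiplicative.toAdd.injective
  ext l
  simp
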